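/- Let $k$ be an algebraically closed field (of any characteristic) and let $V\subseteq\mathbb A^n=k^n$ be a Zariski closed subset that is equidimensional of codimension $m$, i.e. every irreducible component of $V$ has dimension $n-m$, where $0\le m\le n$. Suppose $V$ has degree $d$, meaning that $\#(H\cap V)=d$ for a generic affine-linear subspace $H\subseteq\mathbb A^n$ of dimension $m$. (Generic: for all $m$-dimensional $H=\{x : Ax=b\}$, $A\in k^{(n-m)\times n}$, $b\in k^{n-m}$, with $(A,b)$ in some nonempty Zariski open subset of the space of coefficients.) Then there exists an ideal $\mathfrak q\subseteq k[x_1,\ldots,x_n]$, generated by polynomials of total degree $\le d$, such that $\sqrt{\mathfrak q}=\mathbb I(V)$, the ideal of all polynomials vanishing on $V$. In particular, the zero set of $\mathfrak q$ is $\mathbb V(\mathfrak q)=V$. -/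

import Mathlib

namespace AffineDegree

variable {k : Type*} [Field k] {n : ℕ}

/-- A subset of affine space `k ^ n` is Zariski closed if it is the set of common zeros of
an ideal of polynomials. -/
def IsZariskiClosed (V : Set (Fin n → k)) : Prop :=
  ∃ I : Ideal (MvPolynomial (Fin n) k), V = MvPolynomial.zeroLocus k I

/-- An irreducible (in particular nonempty) Zariski closed subset of affine space. -/
def IsIrreducibleClosed (Z : Set (Fin n → k)) : Prop :=
  IsZariskiClosed Z ∧ (MvPolynomial.vanishingIdeal k Z).IsPrime

/-- The irreducible components of `V`: the maximal irreducible closed subsets of `V`. -/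
def IsComponent (V Z : Set (Fin n → k)) : Prop :=
  Maximal (fun Y : Set (Fin n → k) => IsIrreducibleClosed Y ∧ Y ⊆ V) Z

/-- The dimension of a closed subset: the Krull dimension of its coordinate ring. -/
noncomputable def dim (Z : Set (Fin n → k)) : WithBot ℕ∞ :=
  ringKrullDim (MvPolynomial (Fin n) k ⧸ MvPolynomial.vanishingIdeal k Z)

/-- `V` is a Zariski closed subset of `k ^ n`, all of whose irreducible components have
codimension `m`. -/
def IsEquidimensional (V : Set (Fin n → k)) (m : ℕ) : Prop :=
  m ≤ n ∧ IsZariskiClosed V ∧ ∀ Z, IsComponent V Z → dim Z = ((n - m : ℕ) : WithBot ℕ∞)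

/-- The affine-linear subspace of `k ^ n` cut out by the `r` equations `A x = b`. It has
dimension `n - r` when `A` has rank `r`, and all affine-linear subspaces of that dimension
arise in this way. -/
def linearSubspace {r : ℕ} (A : Matrix (Fin r) (Fin n) k) (b : Fin r → k) :
    Set (Fin n → k) :=
  {x | A.mulVec x = b}

/-- `property H` holds for a generic affine-linear subspace `H` of `k ^ n` of codimension `r`:
it holds for all `H = {x | A x = b}`, with `A` of rank `r`, such that the coefficients `(A, b)`
lie in a nonempty basic Zariski open set `P ≠ 0` of the space of coefficients. -/
def ForGenericSubspace (r : ℕ) (property : Set (Fin n → k) → Prop) : Prop :=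
  ∃ P : MvPolynomial ((Fin r × Fin n) ⊕ Fin r) k, P ≠ 0 ∧
    ∀ (A : Matrix (Fin r) (Fin n) k) (b : Fin r → k),
      A.rank = r →
      MvPolynomial.eval (Sum.elim (fun ij : Fin r × Fin n => A ij.1 ij.2) b) P ≠ 0 →
      property (linearSubspace A b)

/-- `V` is an equidimensional Zariski closed subset of `k ^ n`, of some codimension `m`, and
has degree `d`: a generic affine-linear subspace `H` of dimension `m`, that is, of
codimension `n - m`, meets `V` in exactly `d` points. -/
def HasDegree (V : Set (Fin n → k)) (d : ℕ) : Prop :=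
  ∃ m : ℕ, IsEquidimensional V m ∧
    ForGenericSubspace (n - m) (fun H : Set (Fin n → k) => (H ∩ V).encard = (d : ℕ∞))

end AffineDegree

/-!
The proof finds, for every point `x` outside of `V`, a polynomial of degree at most `d` that vanishes
on `V` and not at `x`. The ideal generated by all polynomials of degree at most `d` vanishing on `V`
then has zero set `V`, and its radical is the vanishing ideal of `V` by the Nullstellensatz.

The polynomial is the equation of a projection of `V`. Let `r = dim V`. A generic choice of `r`
linear forms `A` makes `V` finite over affine `r`-space
(`exists_generic_projHom_isIntegral`, a linear Noether normalization), so that only finitely many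
points of `V` have the same image as `x` under `A`, and a further linear form `l` separates `x` from
these. The projection `(l, A)` to affine `(r + 1)`-space is finite and maps each component of `V`
onto an irreducible hypersurface, whose equation is the minimal polynomial of `l` over `k[A]`
(`exists_irreducible_projHom_eq_zero_iff`). Let `F` be the product of the distinct equations. By
lying over, every zero of `F` is the image of a point of `V`; hence `F` does not vanish at the image
of `x`.

It remains to see that `deg F ≤ d`. A generic line in affine `(r + 1)`-space meets `F = 0` in
`deg F` distinct points (`exists_line_meeting_hypersurface`): for a generic direction `(1, w)`
the restriction of `F` to the lines in this direction has full degree, and it is separable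
on a generic such line, because the irreducible factors of `F` are distinct and each has a nonzero
directional derivative, `k` being perfect. Each of the points lifts to a point of `V`, on the preimage
of the line, which is the linear subspace `(A - w ⊗ l) z = t`. As `A`, `w` and `t` may be chosen to
satisfy one more open condition, this subspace is one of those that meet `V` in exactly `d` points.
-/

namespace AffineDegree

open MvPolynomial

variable {k : Type*} [Field k]

/-! ### Integral extensions: dimension and lifting of points -/

/-- By incomparability, contraction of primes along an integral extension is strictly monotone. -/
theorem ringKrullDim_le_of_isIntegral (R S : Type*) [CommRing R] [CommRing S] [Algebra R S]
    [Algebra.IsIntegral R S] : ringKrullDim S ≤ ringKrullDim R := by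
  refine Order.krullDim_le_of_strictMono (PrimeSpectrum.comap (algebraMap R S)) fun p q hpq => ?_
  obtain ⟨x, hxq, hxp⟩ := Set.exists_of_ssubset (show (p.asIdeal : Set S) ⊂ q.asIdeal from hpq)
  exact Ideal.comap_lt_comap_of_integral_mem_sdiff hpq.le ⟨hxq, hxp⟩
    (Algebra.IsIntegral.isIntegral x)

/-- By lying over and going up, chains of primes lift along an injective integral extension. -/
theorem ringKrullDim_le_of_isIntegral_of_injective (R S : Type*) [CommRing R] [CommRing S]
    [Algebra R S] [Algebra.IsIntegral R S] (hinj : Function.Injective (algebraMap R S)) :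
    ringKrullDim R ≤ ringKrullDim S := by
  refine iSup_le fun l => ?_
  obtain ⟨Q, -, hQ, hQl⟩ := Ideal.exists_ideal_over_prime_of_isIntegral l.head.asIdeal (⊥ : Ideal S)
    (by rw [← RingHom.ker_eq_comap_bot, (RingHom.injective_iff_ker_eq_bot _).mp hinj]; exact bot_le)
  have : Q.LiesOver l.head.asIdeal := ⟨hQl.symm⟩
  obtain ⟨L, hL, -, -⟩ := Ideal.exists_ltSeries_of_hasGoingUp l Q
  exact hL ▸ Order.LTSeries.length_le_krullDim L

/-- By dimension, an integral ring map out of a polynomial ring into a ring of smaller dimension has a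
nonzero kernel. -/
theorem exists_ne_zero_map_eq_zero {r : ℕ} {S : Type*} [CommRing S]
    (φ : MvPolynomial (Fin r) k →+* S) (hφ : φ.IsIntegral) (hS : ringKrullDim S < r) :
    ∃ f ≠ 0, φ f = 0 := by
  by_contra! h
  algebraize [φ]
  have := ringKrullDim_le_of_isIntegral_of_injective (MvPolynomial (Fin r) k) S
    ((injective_iff_map_eq_zero φ).mpr fun f hf => by_contra fun h0 => h f h0 hf)
  rw [MvPolynomial.ringKrullDim_of_isNoetherianRing, ringKrullDim_eq_zero_of_field] at this
  simp only [Nat.card_eq_fintype_card, Fintype.card_fin, zero_add] at this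
  exact absurd hS (not_lt.mpr this)

/-- By dimension, an integral ring map from a polynomial ring in `r` variables into a ring
of dimension at least `r` is injective. -/
theorem injective_of_isIntegral_of_le_ringKrullDim {r : ℕ} {S : Type*} [CommRing S]
    (φ : MvPolynomial (Fin r) k →+* S) (hφ : φ.IsIntegral) (hS : r ≤ ringKrullDim S) :
    Function.Injective φ := by
  rw [injective_iff_map_eq_zero]
  intro f hf
  by_contra h0
  let I := RingHom.ker φ
  let ψ : MvPolynomial (Fin r) k ⧸ I →+* S := RingHom.kerLift φ
  have hψ : ψ.IsIntegral := by
    refine RingHom.IsIntegral.tower_top (Ideal.Quotient.mk I) ψ ?_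
    have : ψ.comp (Ideal.Quotient.mk I) = φ := RingHom.ext fun x => RingHom.kerLift_mk φ x
    rwa [this]
  algebraize [ψ]
  have h1 := ringKrullDim_le_of_isIntegral (MvPolynomial (Fin r) k ⧸ I) S
  have h2 := ringKrullDim_succ_le_of_surjective (Ideal.Quotient.mk I)
    Ideal.Quotient.mk_surjective (mem_nonZeroDivisors_of_ne_zero h0)
    (Ideal.Quotient.eq_zero_iff_mem.mpr hf)
  rw [MvPolynomial.ringKrullDim_of_isNoetherianRing, ringKrullDim_eq_zero_of_field] at h2
  simp only [Nat.card_eq_fintype_card, Fintype.card_fin, zero_add] at h2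
  have h3 : (r : WithBot ℕ∞) + 1 ≤ r := (add_le_add_left (hS.trans h1) 1).trans h2
  have h4 : ((r + 1 : ℕ) : WithBot ℕ∞) ≤ (r : ℕ) := by exact_mod_cast h3
  have : r + 1 ≤ r := by exact_mod_cast h4
  omega

/-- Lying over combined with the Nullstellensatz: a point of affine space on which the kernel of
an integral map into the coordinate ring of `zeroLocus k p` vanishes lifts to `zeroLocus k p`. -/
theorem exists_mem_zeroLocus_of_ker_vanishes [IsAlgClosed k] {n s : ℕ}
    (p : Ideal (MvPolynomial (Fin n) k)) (φ : MvPolynomial (Fin s) k →ₐ[k] MvPolynomial (Fin n) k)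
    (hφ : ((Ideal.Quotient.mk p).comp φ.toRingHom).IsIntegral) (u : Fin s → k)
    (hu : ∀ f, φ f ∈ p → eval u f = 0) :
    ∃ z ∈ zeroLocus k p, ∀ i, eval z (φ (X i)) = u i := by
  let P : Ideal (MvPolynomial (Fin s) k) := vanishingIdeal k {u}
  have hP : P.IsMaximal := isMaximal_iff_eq_vanishingIdeal_singleton.mpr ⟨u, rfl⟩
  obtain ⟨Q, hQ, hQP⟩ : ∃ Q : Ideal (MvPolynomial (Fin n) k ⧸ p), Q.IsMaximal ∧
      Q.comap ((Ideal.Quotient.mk p).comp φ.toRingHom) = P := by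
    let ψ := (Ideal.Quotient.mk p).comp φ.toRingHom
    let := ψ.toAlgebra
    have : Algebra.IsIntegral (MvPolynomial (Fin s) k) (MvPolynomial (Fin n) k ⧸ p) := ⟨hφ⟩
    refine Ideal.exists_ideal_over_maximal_of_isIntegral P fun f hf => ?_
    have : φ f ∈ p := Ideal.Quotient.eq_zero_iff_mem.mp hf
    simpa [P, aeval_eq_eval] using hu f this
  have hM : (Q.comap (Ideal.Quotient.mk p)).IsMaximal :=
    Ideal.comap_isMaximal_of_surjective _ Ideal.Quotient.mk_surjective
  obtain ⟨z, hz⟩ := isMaximal_iff_eq_vanishingIdeal_singleton.mp hM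
  have key : ∀ g, Ideal.Quotient.mk p g ∈ Q ↔ eval z g = 0 := fun g => by
    rw [← Ideal.mem_comap, hz]; simp [aeval_eq_eval]
  refine ⟨z, fun g hg => ?_, fun i => ?_⟩
  · rw [aeval_eq_eval]
    exact (key g).mp (by rw [Ideal.Quotient.eq_zero_iff_mem.mpr hg]; exact Q.zero_mem)
  · have h1 : X i - C (u i) ∈ P := by simp [P]
    rw [← hQP, Ideal.mem_comap] at h1
    have h2 := (key _).mp h1
    have h3 : φ (C (u i)) = C (u i) := φ.commutes (u i)
    simpa [h3, sub_eq_zero] using h2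

/-! ### Shears and generic directions -/

theorem totalDegree_aeval_le_of_totalDegree_le_one {σ τ : Type*} (g : σ → MvPolynomial τ k)
    (hg : ∀ i, (g i).totalDegree ≤ 1) (f : MvPolynomial σ k) :
    (aeval g f).totalDegree ≤ f.totalDegree := by
  rw [aeval_def, eval₂_eq]
  refine totalDegree_finsetSum_le fun α hα => ?_
  refine (totalDegree_mul _ _).trans ?_
  rw [algebraMap_eq, totalDegree_C, zero_add]
  refine (totalDegree_finsetProd _ _).trans (le_trans ?_ (le_totalDegree hα))
  refine Finset.sum_le_sum fun i _ => (totalDegree_pow _ _).trans ?_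
  simpa using Nat.mul_le_mul_left (α i) (hg i)

theorem eval_aeval {σ τ : Type*} (x : τ → k) (g : σ → MvPolynomial τ k) (f : MvPolynomial σ k) :
    eval x (aeval g f) = eval (fun i => eval x (g i)) f := by
  have : (aeval x).comp (aeval g) = aeval fun i => eval x (g i) :=
    MvPolynomial.algHom_ext fun i => by simp [aeval_eq_eval]
  have h := congr($this f)
  rw [AlgHom.comp_apply, aeval_eq_eval, aeval_eq_eval] at h
  exact h

theorem exists_eval_ne_zero [Infinite k] {σ : Type*} {f : MvPolynomial σ k} (hf : f ≠ 0) :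
    ∃ x, eval x f ≠ 0 := by
  by_contra! h
  exact hf (MvPolynomial.funext fun x => by simpa using h x)

theorem eval_mul_of_isHomogeneous {σ : Type*} [Fintype σ] {f : MvPolynomial σ k} {N : ℕ}
    (hf : f.IsHomogeneous N) (c : k) (v : σ → k) :
    eval (fun i => c * v i) f = c ^ N * eval v f := by
  rw [eval_eq', eval_eq', Finset.mul_sum]
  refine Finset.sum_congr rfl fun α hα => ?_
  have : ∑ i, α i = N := by
    have := hf (mem_support_iff.mp hα)
    rw [Finsupp.weight_apply, Finsupp.sum_fintype _ _ (by simp)] at this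
    simpa using this
  simp only [mul_pow, Finset.prod_mul_distrib, Finset.prod_pow_eq_pow_sum, this]
  ring

/-- The automorphism of `k[y, t₁, …, tᵣ]` with `y ↦ y` and `tᵢ ↦ tᵢ + wᵢ y`. -/
noncomputable def shearHom {r : ℕ} (w : Fin r → k) :
    MvPolynomial (Fin (r + 1)) k →ₐ[k] MvPolynomial (Fin (r + 1)) k :=
  aeval (Fin.cons (X 0) fun i => X i.succ + C (w i) * X 0)

@[simp] theorem shearHom_X_zero {r : ℕ} (w : Fin r → k) : shearHom w (X 0) = X 0 := by
  simp [shearHom]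

@[simp] theorem shearHom_X_succ {r : ℕ} (w : Fin r → k) (i : Fin r) :
    shearHom w (X i.succ) = X i.succ + C (w i) * X 0 := by
  simp [shearHom]

theorem shearHom_comp_neg {r : ℕ} (w : Fin r → k) :
    (shearHom w).comp (shearHom (-w)) = AlgHom.id k _ := by
  refine MvPolynomial.algHom_ext fun i => ?_
  refine Fin.cases (by simp) (fun i => ?_) i
  simp only [AlgHom.comp_apply, shearHom_X_succ, map_add, map_mul, shearHom_X_zero, Pi.neg_apply,
    map_neg, AlgHom.id_apply]
  rw [show shearHom w (C (w i)) = C (w i) from (shearHom w).commutes (w i)]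
  ring

/-- `shearHom` as an automorphism. -/
noncomputable def shear {r : ℕ} (w : Fin r → k) :
    MvPolynomial (Fin (r + 1)) k ≃ₐ[k] MvPolynomial (Fin (r + 1)) k :=
  AlgEquiv.ofAlgHom (shearHom w) (shearHom (-w)) (shearHom_comp_neg w)
    (by simpa using shearHom_comp_neg (-w))

theorem eval_shearHom {r : ℕ} (w : Fin r → k) (s : k) (t : Fin r → k)
    (f : MvPolynomial (Fin (r + 1)) k) :
    eval (Fin.cons s t) (shearHom w f) = eval (Fin.cons s (fun i => t i + w i * s)) f := by
  rw [shearHom, eval_aeval]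
  congr 2
  funext i
  obtain rfl | ⟨i, rfl⟩ := i.eq_zero_or_eq_succ <;> simp

/-- The isomorphism taking `f` to its shear by `w`, as a polynomial in the variable `y` over
`k[t₁, …, tᵣ]`. -/
noncomputable def shearPoly {r : ℕ} (w : Fin r → k) :
    MvPolynomial (Fin (r + 1)) k ≃ₐ[k] Polynomial (MvPolynomial (Fin r) k) :=
  (shear w).trans (finSuccEquiv k r)

theorem shearPoly_apply {r : ℕ} (w : Fin r → k) (f : MvPolynomial (Fin (r + 1)) k) :
    shearPoly w f = finSuccEquiv k r (shearHom w f) := rfl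

@[simp] theorem shearPoly_C {r : ℕ} (w : Fin r → k) (a : k) :
    shearPoly w (C a) = Polynomial.C (C a) := (shearPoly w).commutes a

@[simp] theorem shearPoly_X_zero {r : ℕ} (w : Fin r → k) :
    shearPoly w (X 0) = Polynomial.X := by
  rw [shearPoly_apply, shearHom_X_zero, finSuccEquiv_X_zero]

@[simp] theorem shearPoly_X_succ {r : ℕ} (w : Fin r → k) (i : Fin r) :
    shearPoly w (X i.succ) = Polynomial.C (X i) + Polynomial.C (C (w i)) * Polynomial.X := by
  rw [shearPoly_apply, shearHom_X_succ, map_add, map_mul, finSuccEquiv_X_zero,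
    finSuccEquiv_X_succ]
  congr 2
  exact (finSuccEquiv k r).commutes (w i)

theorem map_constantCoeff_shearPoly {r : ℕ} (w : Fin r → k) (f : MvPolynomial (Fin (r + 1)) k) :
    (shearPoly w f).map constantCoeff =
      aeval (fun i => Polynomial.C ((Fin.cons 1 w : Fin (r + 1) → k) i) * Polynomial.X) f := by
  induction f using MvPolynomial.induction_on with
  | C a => simp
  | add p q hp hq => simp only [map_add, Polynomial.map_add, hp, hq]
  | mul_X p i hp =>
    have hX : (shearPoly w (X i)).map constantCoeff =
        Polynomial.C ((Fin.cons 1 w : Fin (r + 1) → k) i) * Polynomial.X := by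
      obtain rfl | ⟨i, rfl⟩ := i.eq_zero_or_eq_succ
      · simp
      · simp
    rw [map_mul (shearPoly w), Polynomial.map_mul, hp, hX, map_mul, aeval_X]

theorem eval_eval_shearPoly {r : ℕ} (w : Fin r → k) (s : k) (t : Fin r → k)
    (f : MvPolynomial (Fin (r + 1)) k) :
    ((shearPoly w f).map (eval t)).eval s = eval (Fin.cons s (fun i => t i + w i * s)) f := by
  rw [shearPoly_apply, ← eval_eq_eval_mv_eval', eval_shearHom]

/-- The derivative of the sheared polynomial with respect to `y` is the shear of the directional
derivative of `f` in the direction `(1, w)`. -/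
theorem derivative_shearPoly {r : ℕ} (w : Fin r → k) (f : MvPolynomial (Fin (r + 1)) k) :
    Polynomial.derivative (shearPoly w f) =
      shearPoly w (pderiv 0 f + ∑ i : Fin r, C (w i) * pderiv i.succ f) := by
  induction f using MvPolynomial.induction_on with
  | C a => simp
  | add p q hp hq =>
    simp only [map_add, hp, hq, mul_add, Finset.sum_add_distrib]
    ring
  | mul_X p i hp =>
    have key : Polynomial.derivative (shearPoly w (X i)) =
        shearPoly w (pderiv 0 (X i) + ∑ j : Fin r, C (w j) * pderiv j.succ (X i)) := by
      obtain rfl | ⟨i, rfl⟩ := i.eq_zero_or_eq_succ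
      · have : ∀ j : Fin r, pderiv j.succ (X 0 : MvPolynomial (Fin (r + 1)) k) = 0 := fun j =>
          pderiv_X_of_ne (Fin.succ_ne_zero j).symm
        simp [this]
      · rw [pderiv_X_of_ne (Fin.succ_ne_zero i), zero_add,
          Finset.sum_eq_single i (fun j _ hj => by
            rw [pderiv_X_of_ne fun h => hj (Fin.succ_injective _ h).symm, mul_zero]) (by simp)]
        simp
    rw [map_mul, Polynomial.derivative_mul, hp, key, ← map_mul, ← map_mul, ← map_add]
    congr 1
    simp only [Derivation.leibniz, smul_eq_mul, add_mul, mul_add, Finset.sum_mul, Finset.mul_sum,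
      Finset.sum_add_distrib]
    have : ∀ j : Fin r, C (w j) * (p * pderiv j.succ (X i)) = p * (C (w j) * pderiv j.succ (X i)) :=
      fun j => by ring
    have h' : ∀ j : Fin r, C (w j) * (X i * pderiv j.succ p) = C (w j) * pderiv j.succ p * X i :=
      fun j => by ring
    simp only [this, h']
    ring

theorem coeff_aeval_C_mul_X {σ : Type*} [Fintype σ] (v : σ → k) (f : MvPolynomial σ k) (N : ℕ) :
    (aeval (fun i => Polynomial.C (v i) * Polynomial.X) f : Polynomial k).coeff N =
      eval v (homogeneousComponent N f) := by
  induction f using MvPolynomial.induction_on' with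
  | monomial α a =>
    have h1 : (aeval (fun i => Polynomial.C (v i) * Polynomial.X) (monomial α a) : Polynomial k) =
        Polynomial.C (a * ∏ i, v i ^ α i) * Polynomial.X ^ (∑ i, α i) := by
      rw [aeval_monomial, Finsupp.prod_fintype _ _ (by simp)]
      simp only [mul_pow, Finset.prod_mul_distrib, Finset.prod_pow_eq_pow_sum, map_mul, map_prod,
        map_pow, Polynomial.algebraMap_eq]
      ring
    rw [h1, Polynomial.coeff_C_mul_X_pow]
    have h2 : α.degree = ∑ i, α i := Finsupp.degree_eq_sum α
    by_cases h : N = ∑ i, α i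
    · rw [if_pos h, homogeneousComponent_of_mem (n := N) (isHomogeneous_monomial a (h2.trans h.symm)),
        if_pos rfl, eval_monomial, Finsupp.prod_fintype _ _ (by simp)]
    · rw [if_neg h, homogeneousComponent_of_mem (n := ∑ i, α i) (isHomogeneous_monomial a h2),
        if_neg h, map_zero]
  | add p q hp hq => simp only [map_add, Polynomial.coeff_add, hp, hq]

theorem homogeneousComponent_totalDegree_ne_zero {σ : Type*} {f : MvPolynomial σ k} (hf : f ≠ 0) :
    homogeneousComponent f.totalDegree f ≠ 0 := by
  obtain ⟨α, hα, h⟩ := Finset.exists_mem_eq_sup f.support (support_nonempty.mpr hf)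
    (fun s => s.sum fun _ e => e)
  intro h0
  have := congr(coeff α $h0)
  rw [coeff_homogeneousComponent, if_pos, coeff_zero] at this
  · exact mem_support_iff.mp hα this
  · exact h.symm

/-- For generic `w` the sheared polynomial has, in the variable `y`, the full degree of `f`, with a
constant leading coefficient: the value at `(1, w)` of the top homogeneous component of `f`. -/
theorem exists_generic_leadingCoeff [Infinite k] {r : ℕ} {f : MvPolynomial (Fin (r + 1)) k}
    (hf : f ≠ 0) :
    ∃ q : MvPolynomial (Fin r) k, q ≠ 0 ∧ ∀ w, eval w q ≠ 0 →
      (shearPoly w f).natDegree = f.totalDegree ∧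
        ∃ c ≠ 0, (shearPoly w f).leadingCoeff = C c := by
  set e := f.totalDegree with he
  set g := homogeneousComponent e f with hg
  have hghom : g.IsHomogeneous e := homogeneousComponent_isHomogeneous e f
  have hev : ∀ w : Fin r → k, eval w (aeval (Fin.cons 1 X : Fin (r + 1) →
      MvPolynomial (Fin r) k) g) =
      eval (Fin.cons 1 w) g := fun w => by
    rw [eval_aeval]
    congr 2
    funext i
    obtain rfl | ⟨i, rfl⟩ := i.eq_zero_or_eq_succ <;> simp
  refine ⟨aeval (Fin.cons 1 X : Fin (r + 1) → MvPolynomial (Fin r) k) g, ?_, ?_⟩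
  · intro h0
    apply homogeneousComponent_totalDegree_ne_zero hf
    rw [← he, ← hg]
    -- By homogeneity, a zero at all `(1, w)` means a zero at all `v` with `v 0 ≠ 0`.
    have : X 0 * g = 0 := by
      refine MvPolynomial.funext fun v => ?_
      rw [map_mul, eval_X, map_zero]
      by_cases hv : v 0 = 0
      · rw [hv, zero_mul]
      · have h1 := hev (fun i => (v 0)⁻¹ * v i.succ)
        rw [h0, map_zero] at h1
        have h2 : v = fun i => v 0 *
            (Fin.cons 1 (fun i => (v 0)⁻¹ * v i.succ) : Fin (r + 1) → k) i := by
          funext i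
          refine Fin.cases (by simp) (fun i => ?_) i
          simp [hv]
        rw [h2, eval_mul_of_isHomogeneous hghom, ← h1]
        simp
    exact (mul_eq_zero.mp this).resolve_left (X_ne_zero 0)
  · intro w hw
    rw [hev] at hw
    have hdeg : (shearHom w f).totalDegree ≤ e := by
      refine totalDegree_aeval_le_of_totalDegree_le_one _ (fun i => ?_) f
      refine Fin.cases (by simp) (fun i => ?_) i
      rw [Fin.cons_succ]
      refine (totalDegree_add _ _).trans (max_le (by simp) ?_)
      refine (totalDegree_mul _ _).trans ?_
      simp
    have hc : constantCoeff ((shearPoly w f).coeff e) = eval (Fin.cons 1 w) g := by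
      rw [← Polynomial.coeff_map, map_constantCoeff_shearPoly, coeff_aeval_C_mul_X]
    have hne : (shearPoly w f).coeff e ≠ 0 := fun h => hw (by rw [← hc, h, map_zero])
    have hle := totalDegree_coeff_finSuccEquiv_add_le (shearHom w f) e hne
    have h0 : ((shearPoly w f).coeff e).totalDegree = 0 := by
      rw [shearPoly_apply] at hne ⊢; omega
    have hnat : (shearPoly w f).natDegree = e := by
      refine le_antisymm ?_ (Polynomial.le_natDegree_of_ne_zero hne)
      rw [shearPoly_apply, natDegree_finSuccEquiv]
      exact (degreeOf_le_totalDegree _ _).trans hdeg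
    refine ⟨hnat, coeff 0 ((shearPoly w f).coeff e), ?_, ?_⟩
    · rw [← constantCoeff_eq, hc]; exact hw
    · rw [Polynomial.leadingCoeff, hnat]
      exact totalDegree_eq_zero_iff_eq_C.mp h0

/-! ### Separability of irreducible polynomials in a generic direction -/

/-- Over a perfect field an irreducible polynomial has a nonzero partial derivative: otherwise it
would be constant in characteristic zero, and a `p`-th power in characteristic `p`. -/
theorem exists_pderiv_ne_zero_of_irreducible [IsAlgClosed k] {σ : Type*}
    {f : MvPolynomial σ k} (hf : Irreducible f) : ∃ i, pderiv i f ≠ 0 := by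
  by_contra! h
  have hcast : ∀ α ∈ f.support, ∀ i, ((α i : ℕ) : k) = 0 := fun α hα i => by
    by_cases hi : α i = 0
    · simp [hi]
    · have := coeff_pderiv (i := i) f (α - Finsupp.single i 1)
      rw [h i, coeff_zero, tsub_add_cancel_of_le
        (Finsupp.single_le_iff.mpr (Nat.one_le_iff_ne_zero.mpr hi)), Finsupp.tsub_apply,
        Finsupp.single_eq_same, ← Nat.cast_succ, Nat.succ_eq_add_one, Nat.sub_one_add_one hi] at this
      exact (mul_eq_zero.mp this.symm).resolve_left (mem_support_iff.mp hα)
  obtain ⟨p, hp⟩ := CharP.exists k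
  have hdvd : ∀ α ∈ f.support, ∀ i, p ∣ α i := fun α hα i =>
    (CharP.cast_eq_zero_iff k p _).mp (hcast α hα i)
  rcases CharP.char_is_prime_or_zero k p with hprime | rfl
  · have := Fact.mk hprime
    choose c hc using fun a : k => IsAlgClosed.exists_pow_nat_eq a hprime.pos
    let g : MvPolynomial σ k :=
      ∑ α ∈ f.support, monomial (α.mapRange (· / p) (Nat.zero_div p)) (c (coeff α f))
    have hg : g ^ p = f := by
      rw [sum_pow_char]
      conv_rhs => rw [f.as_sum]
      refine Finset.sum_congr rfl fun α hα => ?_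
      have hp' : p • α.mapRange (· / p) (Nat.zero_div p) = α := Finsupp.ext fun i => by
        simp [Nat.mul_div_cancel' (hdvd α hα i)]
      rw [monomial_pow, hc, hp']
    exact not_irreducible_pow hprime.ne_one (hg ▸ hf)
  · have hC : f = C (coeff 0 f) := by
      rw [← totalDegree_eq_zero_iff_eq_C, totalDegree_eq_zero_iff]
      exact fun α hα i => zero_dvd_iff.mp (hdvd α hα i)
    have h0 : coeff 0 f ≠ 0 := fun h0 => hf.ne_zero (by rw [hC, h0, map_zero])
    exact hf.not_isUnit (hC ▸ (isUnit_iff_ne_zero.mpr h0).map C)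

/-- For generic `w` the shear of an irreducible polynomial by `w` has nonzero derivative with
respect to `y`. -/
theorem exists_generic_derivative_ne_zero [IsAlgClosed k] {r : ℕ}
    {f : MvPolynomial (Fin (r + 1)) k} (hf : Irreducible f) :
    ∃ q : MvPolynomial (Fin r) k, q ≠ 0 ∧ ∀ w, eval w q ≠ 0 →
      Polynomial.derivative (shearPoly w f) ≠ 0 := by
  obtain ⟨i, hi⟩ := exists_pderiv_ne_zero_of_irreducible hf
  obtain ⟨α, hα⟩ := MvPolynomial.ne_zero_iff.mp hi
  -- A coefficient of the directional derivative in direction `(1, w)`, as a polynomial in `w`.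
  refine ⟨C (coeff α (pderiv 0 f)) + ∑ j : Fin r, C (coeff α (pderiv j.succ f)) * X j, ?_, ?_⟩
  · intro h0
    apply hα
    obtain rfl | ⟨j, rfl⟩ := i.eq_zero_or_eq_succ
    · simpa using congr(eval 0 $h0)
    · have h1 := congr(eval 0 $h0)
      have h2 := congr(eval (Pi.single j 1) $h0)
      simp only [map_add, eval_C, map_sum, map_mul, eval_X, Pi.zero_apply, mul_zero,
        Finset.sum_const_zero, add_zero, map_zero] at h1
      simpa [h1, Pi.single_apply] using h2
  · intro w hw h0
    apply hw
    rw [derivative_shearPoly, EmbeddingLike.map_eq_zero_iff] at h0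
    have := congr(coeff α $h0)
    simp only [coeff_add, coeff_sum, coeff_C_mul, coeff_zero] at this
    simpa [mul_comm] using this

/-- Suppose that finitely many non-associated irreducible polynomials over a factorial domain have
unit leading coefficient and nonzero derivative. Then their product `G` is separable
over the fraction field; clearing denominators, `a * G + b * G' = h` with `h` a nonzero constant. -/
theorem exists_mul_add_mul_derivative_eq_C {R : Type*} [CommRing R] [IsDomain R]
    [UniqueFactorizationMonoid R] {ι : Type*} (s : Finset ι) (G : ι → Polynomial R)
    (hirr : ∀ i ∈ s, Irreducible (G i)) (hlead : ∀ i ∈ s, IsUnit (G i).leadingCoeff)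
    (hder : ∀ i ∈ s, Polynomial.derivative (G i) ≠ 0)
    (hne : ∀ i ∈ s, ∀ j ∈ s, i ≠ j → ¬ Associated (G i) (G j)) :
    ∃ a b : Polynomial R, ∃ h ≠ 0,
      a * ∏ i ∈ s, G i + b * Polynomial.derivative (∏ i ∈ s, G i) = Polynomial.C h := by
  let K := FractionRing R
  have := UniqueFactorizationMonoid.toGCDMonoid R
  have hprim : ∀ i ∈ s, (G i).IsPrimitive := fun i hi =>
    Polynomial.isPrimitive_iff_isUnit_of_C_dvd.mpr fun r hr =>
      isUnit_of_dvd_unit (by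
        rw [Polynomial.leadingCoeff]
        exact Polynomial.C_dvd_iff_dvd_coeff _ _ |>.mp hr _) (hlead i hi)
  have hinj : Function.Injective (Polynomial.map (algebraMap R K)) :=
    Polynomial.map_injective _ (IsFractionRing.injective R K)
  have hirrK : ∀ i ∈ s, Irreducible ((G i).map (algebraMap R K)) := fun i hi =>
    (hprim i hi).irreducible_iff_irreducible_map_fraction_map.mp (hirr i hi)
  have hsep : (∏ i ∈ s, (G i).map (algebraMap R K)).Separable := by
    refine Polynomial.separable_prod' (fun i hi j hj hij => ?_) fun i hi => ?_
    · refine ((hirrK i hi).coprime_iff_not_dvd).mpr fun hd => hne i hi j hj hij ?_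
      exact (hirr i hi).associated_of_dvd (hirr j hj)
        (((hprim i hi).dvd_iff_fraction_map_dvd_fraction_map K).mpr hd)
    · rw [Polynomial.separable_iff_derivative_ne_zero (hirrK i hi), Polynomial.derivative_map]
      exact fun h0 => hder i hi (hinj (by rw [h0, Polynomial.map_zero]))
  rw [← Polynomial.map_prod, Polynomial.separable_def] at hsep
  obtain ⟨a, b, hab⟩ := hsep
  obtain ⟨c, hc, ha⟩ := IsLocalization.integerNormalization_spec (nonZeroDivisors R) a
  obtain ⟨d, hd, hb⟩ := IsLocalization.integerNormalization_spec (nonZeroDivisors R) b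
  refine ⟨Polynomial.C d * IsLocalization.integerNormalization (nonZeroDivisors R) a,
    Polynomial.C c * IsLocalization.integerNormalization (nonZeroDivisors R) b, c * d,
    mul_ne_zero (nonZeroDivisors.ne_zero hc) (nonZeroDivisors.ne_zero hd), hinj ?_⟩
  rw [Polynomial.derivative_map] at hab
  have hsmul : ∀ (r : R) (q : Polynomial K), r • q = Polynomial.C (algebraMap R K r) * q :=
    fun r q => by rw [← Polynomial.smul_eq_C_mul, algebraMap_smul]
  rw [Polynomial.map_add, Polynomial.map_mul, Polynomial.map_mul, Polynomial.map_mul,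
    Polynomial.map_mul, ha, hb, hsmul, hsmul, Polynomial.map_C, Polynomial.map_C, Polynomial.map_C,
    map_mul, map_mul]
  linear_combination Polynomial.C (algebraMap R K c) * Polynomial.C (algebraMap R K d) * hab

/-! ### Linear projections and linear Noether normalization -/

variable {n : ℕ}

/-- The substitution of linear forms `k[t₁, …, tₛ] → k[x₁, …, xₙ]`, `tᵢ ↦ ∑ⱼ Aᵢⱼ xⱼ`, that is,
the comorphism of the linear map `x ↦ A x`. -/
noncomputable def linMap {s : ℕ} (A : Fin s → Fin n → k) :
    MvPolynomial (Fin s) k →ₐ[k] MvPolynomial (Fin n) k :=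
  aeval fun i => ∑ j, C (A i j) * X j

theorem linMap_X {s : ℕ} (A : Fin s → Fin n → k) (i : Fin s) :
    linMap A (X i) = ∑ j, C (A i j) * X j := by simp [linMap]

theorem linMap_C {s : ℕ} (A : Fin s → Fin n → k) (a : k) : linMap A (C a) = C a :=
  (linMap A).commutes a

theorem eval_linMap {s : ℕ} (A : Fin s → Fin n → k) (x : Fin n → k) (f : MvPolynomial (Fin s) k) :
    eval x (linMap A f) = eval (fun i => A i ⬝ᵥ x) f := by
  rw [linMap, eval_aeval]
  simp [dotProduct]

theorem totalDegree_linMap_le {s : ℕ} (A : Fin s → Fin n → k) (f : MvPolynomial (Fin s) k) :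
    (linMap A f).totalDegree ≤ f.totalDegree := by
  refine totalDegree_aeval_le_of_totalDegree_le_one _ (fun i => ?_) f
  refine totalDegree_finsetSum_le fun j _ => (totalDegree_mul _ _).trans ?_
  simp

theorem linMap_cons_shearHom {r : ℕ} (A : Fin r → Fin n → k) (l : Fin n → k) (w : Fin r → k)
    (f : MvPolynomial (Fin (r + 1)) k) :
    linMap (Fin.cons l fun i => A i - w i • l) (shearHom w f) = linMap (Fin.cons l A) f := by
  have : (linMap (Fin.cons l fun i => A i - w i • l)).comp (shearHom w) =
      linMap (Fin.cons l A) := by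
    refine MvPolynomial.algHom_ext fun i => ?_
    obtain rfl | ⟨i, rfl⟩ := i.eq_zero_or_eq_succ
    · simp [linMap_X]
    · simp only [AlgHom.comp_apply, shearHom_X_succ, map_add, map_mul, linMap_X, linMap_C,
        Fin.cons_succ, Fin.cons_zero, Finset.mul_sum, ← Finset.sum_add_distrib]
      refine Finset.sum_congr rfl fun j _ => ?_
      simp only [Pi.sub_apply, Pi.smul_apply, smul_eq_mul, map_sub, map_mul]
      ring
  exact congr($this f)

/-- The ring map dual to the projection `x ↦ A x` restricted to the scheme defined by `I`. -/
noncomputable def projHom {s : ℕ} (A : Fin s → Fin n → k) (I : Ideal (MvPolynomial (Fin n) k)) :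
    MvPolynomial (Fin s) k →+* MvPolynomial (Fin n) k ⧸ I :=
  (Ideal.Quotient.mk I).comp (linMap A).toRingHom

theorem projHom_apply {s : ℕ} (A : Fin s → Fin n → k) (I : Ideal (MvPolynomial (Fin n) k))
    (f : MvPolynomial (Fin s) k) : projHom A I f = Ideal.Quotient.mk I (linMap A f) := rfl

theorem projHom_eq_zero_iff {s : ℕ} {A : Fin s → Fin n → k} {I : Ideal (MvPolynomial (Fin n) k)}
    {f : MvPolynomial (Fin s) k} : projHom A I f = 0 ↔ linMap A f ∈ I :=
  Ideal.Quotient.eq_zero_iff_mem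

theorem projHom_isIntegral_mono {s : ℕ} {A : Fin s → Fin n → k}
    {I J : Ideal (MvPolynomial (Fin n) k)} (hIJ : I ≤ J) (h : (projHom A I).IsIntegral) :
    (projHom A J).IsIntegral :=
  h.trans (projHom A I) (Ideal.Quotient.factor hIJ)
    (RingHom.isIntegral_of_surjective _ (Ideal.Quotient.factor_surjective hIJ))

theorem eval₂_projHom {r : ℕ} (A : Fin r → Fin n → k) (l : Fin n → k)
    (I : Ideal (MvPolynomial (Fin n) k)) (g : MvPolynomial (Fin (r + 1)) k) :
    (finSuccEquiv k r g).eval₂ (projHom A I) (Ideal.Quotient.mk I (∑ j, C (l j) * X j)) =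
      projHom (Fin.cons l A) I g := by
  have : (Polynomial.eval₂RingHom (projHom A I) (Ideal.Quotient.mk I (∑ j, C (l j) * X j))).comp
      (finSuccEquiv k r).toAlgHom.toRingHom = projHom (Fin.cons l A) I := by
    refine MvPolynomial.ringHom_ext (fun a => ?_) fun i => ?_
    · have : finSuccEquiv k r (C a) = Polynomial.C (C a) := (finSuccEquiv k r).commutes a
      simp [this, projHom_apply]
    · obtain rfl | ⟨i, rfl⟩ := i.eq_zero_or_eq_succ
      · simp [finSuccEquiv_X_zero, projHom_apply, linMap_X]
      · simp [finSuccEquiv_X_succ, projHom_apply, linMap_X]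
  exact congr($this g)

theorem projHom_cons_isIntegral {r : ℕ} {A : Fin r → Fin n → k}
    {I : Ideal (MvPolynomial (Fin n) k)} (h : (projHom A I).IsIntegral) (l : Fin n → k) :
    (projHom (Fin.cons l A) I).IsIntegral := by
  let ρ : MvPolynomial (Fin r) k →+* MvPolynomial (Fin (r + 1)) k :=
    (rename Fin.succ : MvPolynomial (Fin r) k →ₐ[k] MvPolynomial (Fin (r + 1)) k).toRingHom
  have hρ : (projHom (Fin.cons l A) I).comp ρ = projHom A I := by
    refine MvPolynomial.ringHom_ext (fun a => ?_) fun i => ?_ <;> simp [projHom_apply, linMap, ρ]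
  exact RingHom.IsIntegral.tower_top ρ _ (hρ ▸ h)

/-- If the images of the forms `l, A₁, …, Aᵣ` satisfy an equation `f` whose shear by `w` is monic in
`y` up to a constant, then `l` can be dropped after replacing each `Aᵢ` by `Aᵢ - wᵢ l`. -/
theorem projHom_sub_isIntegral {r : ℕ} {A : Fin r → Fin n → k} {l : Fin n → k}
    {I : Ideal (MvPolynomial (Fin n) k)} (h : (projHom (Fin.cons l A) I).IsIntegral)
    {f : MvPolynomial (Fin (r + 1)) k} (hf : projHom (Fin.cons l A) I f = 0)
    {w : Fin r → k} {c : k} (hc : c ≠ 0) (hlead : (shearPoly w f).leadingCoeff = C c) :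
    (projHom (fun i => A i - w i • l) I).IsIntegral := by
  set A' : Fin r → Fin n → k := fun i => A i - w i • l with hA'
  have hshear : ∀ g, projHom (Fin.cons l A') I (shearHom w g) = projHom (Fin.cons l A) I g :=
    fun g => by rw [projHom_apply, projHom_apply, linMap_cons_shearHom]
  have hl : (projHom A' I).IsIntegralElem (Ideal.Quotient.mk I (∑ j, C (l j) * X j)) := by
    refine ⟨Polynomial.C (C c⁻¹) * shearPoly w f, ?_, ?_⟩
    · rw [Polynomial.Monic, Polynomial.leadingCoeff_mul, Polynomial.leadingCoeff_C, hlead, ← C_mul,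
        inv_mul_cancel₀ hc, C_1]
    · rw [Polynomial.eval₂_mul, shearPoly_apply, eval₂_projHom, hshear, hf, mul_zero]
  have hall : ∀ g, (projHom A' I).IsIntegralElem (projHom (Fin.cons l A) I g) := by
    intro g
    rw [← hshear]
    generalize shearHom w g = g
    rw [← eval₂_projHom, Polynomial.eval₂_eq_sum_range]
    refine Finset.sum_induction _ (projHom A' I).IsIntegralElem
      (fun _ _ => RingHom.IsIntegralElem.add _) (RingHom.isIntegralElem_zero _) fun i hi => ?_
    clear hi
    refine RingHom.IsIntegralElem.mul _ (RingHom.isIntegralElem_map _) ?_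
    induction i with
    | zero => simpa using RingHom.isIntegralElem_one _
    | succ i ih => rw [pow_succ]; exact ih.mul _ hl
  -- The image of `k[l, A]` lies in the integral closure `T` of `k[A']`, over which all of the
  -- quotient is therefore integral.
  intro x
  let := (projHom A' I).toAlgebra
  let T := integralClosure (MvPolynomial (Fin r) k) (MvPolynomial (Fin n) k ⧸ I)
  let ψ : MvPolynomial (Fin (r + 1)) k →+* T := (projHom (Fin.cons l A) I).codRestrict T hall
  obtain ⟨P, hP, hPx⟩ := h x
  have : IsIntegral T x := ⟨P.map ψ, hP.map ψ, by rw [Polynomial.eval₂_map]; exact hPx⟩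
  exact isIntegral_trans (R := MvPolynomial (Fin r) k) (A := T) x this

/-- Given `A` outside of the hypersurface `P = 0`, the condition that `A - w ⊗ l` is outside of it
is a nonempty open condition on `w`. -/
theorem exists_generic_sub {r : ℕ} {P : MvPolynomial (Fin r × Fin n) k} {A : Fin r → Fin n → k}
    (hA : eval (fun ij => A ij.1 ij.2) P ≠ 0) (l : Fin n → k) :
    ∃ Q : MvPolynomial (Fin r) k, Q ≠ 0 ∧ ∀ w : Fin r → k,
      eval w Q = eval (fun ij => (A ij.1 - w ij.1 • l) ij.2) P := by
  have hQ : ∀ w : Fin r → k, eval w (aeval (fun ij => C (A ij.1 ij.2) - X ij.1 * C (l ij.2)) P) =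
      eval (fun ij => (A ij.1 - w ij.1 • l) ij.2) P := fun w => by
    rw [eval_aeval]
    simp
  refine ⟨_, fun h0 => hA ?_, hQ⟩
  have := hQ 0
  rw [h0, map_zero] at this
  simpa using this.symm

/-- Linear Noether normalization: if all components of the scheme of the radical ideal `I` have
dimension at most `r`, then its projection by a generic `r × n` matrix is finite. -/
theorem exists_generic_projHom_isIntegral [Infinite k] {I : Ideal (MvPolynomial (Fin n) k)}
    (hI : I.IsRadical) (c : ℕ) : ∀ (r : ℕ), r + c = n →
    (∀ p ∈ I.minimalPrimes, ringKrullDim (MvPolynomial (Fin n) k ⧸ p) ≤ r) →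
    ∀ P : MvPolynomial (Fin r × Fin n) k, P ≠ 0 →
      ∃ A : Fin r → Fin n → k, eval (fun ij => A ij.1 ij.2) P ≠ 0 ∧ (projHom A I).IsIntegral := by
  induction c with
  | zero =>
    rintro r hr - P hP
    obtain rfl : r = n := hr
    obtain ⟨a, ha⟩ := exists_eval_ne_zero
      (mul_ne_zero hP (Matrix.det_mvPolynomialX_ne_zero (Fin r) k))
    rw [map_mul] at ha
    let A : Matrix (Fin r) (Fin r) k := fun i j => a (i, j)
    refine ⟨A, left_ne_zero_of_mul ha, ?_⟩
    have hdet : A.det ≠ 0 := by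
      have := right_ne_zero_of_mul ha
      rw [RingHom.map_det] at this
      convert this
      ext i j
      simp [A]
    refine RingHom.isIntegral_of_surjective _ (Ideal.Quotient.mk_surjective.comp ?_)
    change Function.Surjective (linMap A)
    rw [← AlgHom.range_eq_top, eq_top_iff, ← MvPolynomial.adjoin_range_X, Algebra.adjoin_le_iff]
    rintro _ ⟨j, rfl⟩
    refine ⟨∑ i, C (A⁻¹ j i) * X i, ?_⟩
    have h1 : A⁻¹ * A = 1 := Matrix.nonsing_inv_mul A (isUnit_iff_ne_zero.mpr hdet)
    refine MvPolynomial.funext fun x => ?_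
    change eval x (linMap A _) = _
    rw [eval_linMap]
    have h2 : (A⁻¹.mulVec (A.mulVec x)) j = x j := by
      rw [Matrix.mulVec_mulVec, h1, Matrix.one_mulVec]
    simpa [Matrix.mulVec, dotProduct] using h2
  | succ c ih =>
    intro r hr hdim P hP
    obtain ⟨B, hBP, hB⟩ := ih (r + 1) (by omega)
      (fun p hp => (hdim p hp).trans (by exact_mod_cast Nat.le_succ r))
      (rename (Prod.map Fin.succ id) P)
      (fun h0 => hP (rename_injective _
        ((Fin.succ_injective r).prodMap Function.injective_id) (by rw [h0, map_zero])))
    obtain ⟨l, A, rfl⟩ : ∃ l A, B = Fin.cons l A := ⟨B 0, Fin.tail B, (Fin.cons_self_tail B).symm⟩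
    have hAP : eval (fun ij => A ij.1 ij.2) P ≠ 0 := by
      rw [eval_rename] at hBP
      exact hBP
    -- The `r + 1` forms satisfy an equation on each component, hence, multiplying, on the whole.
    obtain ⟨f, hf0, hf⟩ : ∃ f ≠ 0, projHom (Fin.cons l A) I f = 0 := by
      have hfin := Ideal.finite_minimalPrimes_of_isNoetherianRing _ I
      have key : ∀ p : Ideal (MvPolynomial (Fin n) k), ∃ f ≠ 0, p ∈ I.minimalPrimes →
          linMap (Fin.cons l A) f ∈ p := by
        intro p
        by_cases hp : p ∈ I.minimalPrimes
        · obtain ⟨f, hf0, hf⟩ := exists_ne_zero_map_eq_zero (projHom (Fin.cons l A) p)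
            (projHom_isIntegral_mono hp.1.2 hB)
            ((hdim p hp).trans_lt (by exact_mod_cast Nat.lt_succ_self r))
          exact ⟨f, hf0, fun _ => projHom_eq_zero_iff.mp hf⟩
        · exact ⟨1, one_ne_zero, fun h => absurd h hp⟩
      choose f hf0 hf using key
      refine ⟨∏ p ∈ hfin.toFinset, f p, Finset.prod_ne_zero_iff.mpr fun p _ => hf0 p, ?_⟩
      suffices h : linMap (Fin.cons l A) (∏ p ∈ hfin.toFinset, f p) ∈ sInf I.minimalPrimes by
        rwa [Ideal.sInf_minimalPrimes, hI.radical, ← projHom_eq_zero_iff] at h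
      rw [Ideal.mem_sInf]
      intro p hp
      rw [map_prod]
      exact Ideal.mem_of_dvd _ (Finset.dvd_prod_of_mem _ (hfin.mem_toFinset.mpr hp)) (hf p hp)
    obtain ⟨q, hq0, hq⟩ := exists_generic_leadingCoeff hf0
    obtain ⟨Q, hQ0, hQ⟩ := exists_generic_sub hAP l
    obtain ⟨w, hw⟩ := exists_eval_ne_zero (mul_ne_zero hq0 hQ0)
    rw [map_mul, hQ] at hw
    obtain ⟨-, c, hc0, hc⟩ := hq w (left_ne_zero_of_mul hw)
    exact ⟨fun i => A i - w i • l, right_ne_zero_of_mul hw, projHom_sub_isIntegral hB hf hc0 hc⟩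

theorem finite_fiber_of_projHom_isIntegral {r : ℕ} {A : Fin r → Fin n → k}
    {I : Ideal (MvPolynomial (Fin n) k)} (h : (projHom A I).IsIntegral) (u : Fin r → k) :
    {z ∈ zeroLocus k I | ∀ i, A i ⬝ᵥ z = u i}.Finite := by
  choose P hP hPX using fun j => h (Ideal.Quotient.mk I (X j))
  refine (Set.Finite.pi' fun j => ((P j).map (eval u)).finite_setOfPred_isRoot
    ((hP j).map _).ne_zero).subset ?_
  rintro z ⟨hz, hzu⟩ j
  have hzu : (fun i => A i ⬝ᵥ z) = u := funext hzu
  let ev : MvPolynomial (Fin n) k ⧸ I →+* k :=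
    Ideal.Quotient.lift I (eval z) fun g hg => by simpa [aeval_eq_eval] using hz g hg
  have hev : ev.comp (projHom A I) = eval u := RingHom.ext fun g => by
    rw [← hzu, ← eval_linMap]; rfl
  have := congr(ev $(hPX j))
  rw [Polynomial.hom_eval₂, hev, map_zero] at this
  have hz : ev (Ideal.Quotient.mk I (X j)) = z j := by
    exact (Ideal.Quotient.lift_mk I _ _).trans (eval_X j)
  rw [hz] at this
  simpa [Polynomial.IsRoot, Polynomial.eval_map] using this

/-- A finite projection of an `r`-dimensional irreducible variety to affine `(r + 1)`-space whose
coordinates `A` already give a finite projection to affine `r`-space has a hypersurface as image. Its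
equation `F` is the minimal polynomial of the remaining coordinate `l` over `k[t₁, …, tᵣ]`. -/
theorem exists_irreducible_projHom_eq_zero_iff {r : ℕ} {A : Fin r → Fin n → k}
    {p : Ideal (MvPolynomial (Fin n) k)} [hp : p.IsPrime] (h : (projHom A p).IsIntegral)
    (hdim : r ≤ ringKrullDim (MvPolynomial (Fin n) k ⧸ p)) (l : Fin n → k) :
    ∃ F : MvPolynomial (Fin (r + 1)) k, Irreducible F ∧ (finSuccEquiv k r F).Monic ∧
      ∀ g, linMap (Fin.cons l A) g ∈ p ↔ F ∣ g := by
  have hinj := injective_of_isIntegral_of_le_ringKrullDim _ h hdim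
  let := (projHom A p).toAlgebra
  have : FaithfulSMul (MvPolynomial (Fin r) k) (MvPolynomial (Fin n) k ⧸ p) :=
    (faithfulSMul_iff_algebraMap_injective _ _).mpr hinj
  set y : MvPolynomial (Fin n) k ⧸ p := Ideal.Quotient.mk p (∑ j, C (l j) * X j)
  have hy : IsIntegral (MvPolynomial (Fin r) k) y := h y
  refine ⟨(finSuccEquiv k r).symm (minpoly _ y), ?_, ?_, fun g => ?_⟩
  · rw [MulEquiv.irreducible_iff]
    exact (minpoly.prime_of_isIntegrallyClosed hy).irreducible
  · rw [AlgEquiv.apply_symm_apply]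
    exact minpoly.monic hy
  · rw [← projHom_eq_zero_iff, ← eval₂_projHom, ← map_dvd_iff (finSuccEquiv k r),
      AlgEquiv.apply_symm_apply]
    exact minpoly.isIntegrallyClosed_dvd_iff hy _

/-! ### The degree of the image hypersurface -/

/-- A reduced hypersurface of degree `e` in affine `(r + 1)`-space meets a generic line in at
least `e` points. The line has direction `(1, w)` and passes through `(0, t)`; both `w` and
`t` may be chosen to satisfy further open conditions. -/
theorem exists_line_meeting_hypersurface [IsAlgClosed k] {r : ℕ}
    (S : Finset (MvPolynomial (Fin (r + 1)) k)) (hirr : ∀ F ∈ S, Irreducible F)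
    (hne : ∀ F ∈ S, ∀ G ∈ S, F ≠ G → ¬ Associated F G)
    {Q : MvPolynomial (Fin r) k} (hQ : Q ≠ 0) (T : (Fin r → k) → MvPolynomial (Fin r) k)
    (hT : ∀ w, eval w Q ≠ 0 → T w ≠ 0) :
    ∃ w t : Fin r → k, eval w Q ≠ 0 ∧ eval t (T w) ≠ 0 ∧
      ∃ R : Finset k, R.card = (∏ F ∈ S, F).totalDegree ∧
        ∀ y ∈ R, eval (Fin.cons y fun i => t i + w i * y) (∏ F ∈ S, F) = 0 := by
  have hprod : ∏ F ∈ S, F ≠ 0 := Finset.prod_ne_zero_iff.mpr fun F hF => (hirr F hF).ne_zero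
  obtain ⟨q, hq0, hq⟩ := exists_generic_leadingCoeff hprod
  have hder : ∀ F : MvPolynomial (Fin (r + 1)) k, ∃ q : MvPolynomial (Fin r) k, q ≠ 0 ∧
      (F ∈ S → ∀ w, eval w q ≠ 0 → Polynomial.derivative (shearPoly w F) ≠ 0) := fun F => by
    by_cases hF : F ∈ S
    · obtain ⟨q, hq0, hq⟩ := exists_generic_derivative_ne_zero (hirr F hF)
      exact ⟨q, hq0, fun _ => hq⟩
    · exact ⟨1, one_ne_zero, fun h => absurd h hF⟩
  choose D hD0 hD using hder
  obtain ⟨w, hw⟩ := exists_eval_ne_zero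
    (mul_ne_zero (mul_ne_zero hQ hq0) (Finset.prod_ne_zero_iff.mpr fun F (_ : F ∈ S) => hD0 F))
  simp only [map_mul, mul_ne_zero_iff, map_prod, Finset.prod_ne_zero_iff] at hw
  obtain ⟨⟨hwQ, hwq⟩, hwD⟩ := hw
  obtain ⟨hdeg, c, hc0, hc⟩ := hq w hwq
  have hunit : IsUnit (∏ F ∈ S, (shearPoly w F).leadingCoeff) := by
    rw [← Polynomial.leadingCoeff_prod, ← map_prod, hc]
    exact (isUnit_iff_ne_zero.mpr hc0).map C
  obtain ⟨a, b, h, hh0, hab⟩ := exists_mul_add_mul_derivative_eq_C S (fun F => shearPoly w F)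
    (fun F hF => (MulEquiv.irreducible_iff (shearPoly w)).mpr (hirr F hF))
    (fun F hF => isUnit_of_dvd_unit (Finset.dvd_prod_of_mem
      (fun F => (shearPoly w F).leadingCoeff) hF) hunit)
    (fun F hF => hD F hF w (hwD F hF))
    (fun F hF G hG hFG hass => hne F hF G hG hFG (by
      simpa using hass.map (shearPoly w).symm))
  rw [← map_prod] at hab
  obtain ⟨t, ht⟩ := exists_eval_ne_zero (mul_ne_zero (hT w hwQ) hh0)
  rw [map_mul, mul_ne_zero_iff] at ht
  let g : Polynomial k := (shearPoly w (∏ F ∈ S, F)).map (eval t)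
  have hgdeg : g.natDegree = (∏ F ∈ S, F).totalDegree := by
    rw [← hdeg]
    refine Polynomial.natDegree_map_of_leadingCoeff_ne_zero _ ?_
    rwa [hc, eval_C]
  have hg0 : g ≠ 0 := fun h0 => by
    have := congr(Polynomial.map (eval t) $hab)
    rw [Polynomial.map_add, Polynomial.map_mul, Polynomial.map_mul, ← Polynomial.derivative_map,
      show (shearPoly w (∏ F ∈ S, F)).map (eval t) = 0 from h0] at this
    exact ht.2 (by simpa using this.symm)
  have hgsep : g.Separable := by
    refine ⟨Polynomial.C (eval t h)⁻¹ * a.map (eval t), Polynomial.C (eval t h)⁻¹ * b.map (eval t),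
      ?_⟩
    have := congr(Polynomial.map (eval t) $hab)
    rw [Polynomial.map_add, Polynomial.map_mul, Polynomial.map_mul, ← Polynomial.derivative_map,
      Polynomial.map_C] at this
    rw [mul_assoc, mul_assoc, ← mul_add, this, ← Polynomial.C_mul, inv_mul_cancel₀ ht.2,
      Polynomial.C_1]
  classical
  refine ⟨w, t, hwQ, ht.1, g.roots.toFinset, ?_, fun y hy => ?_⟩
  · rw [Multiset.toFinset_card_of_nodup (Polynomial.nodup_roots hgsep),
      ← (IsAlgClosed.splits g).natDegree_eq_card_roots, hgdeg]
  · rw [← eval_eval_shearPoly]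
    exact (Polynomial.mem_roots hg0).mp (Multiset.mem_toFinset.mp hy)

/-- A generic matrix with `r ≤ n` rows has rank `r`: its leftmost `r × r` minor is nonzero. -/
theorem exists_generic_rank_eq {r : ℕ} (hr : r ≤ n) :
    ∃ D : MvPolynomial (Fin r × Fin n) k, D ≠ 0 ∧ ∀ A : Matrix (Fin r) (Fin n) k,
      eval (fun ij => A ij.1 ij.2) D ≠ 0 → A.rank = r := by
  refine ⟨rename (Prod.map id (Fin.castLE hr)) (Matrix.mvPolynomialX (Fin r) (Fin r) k).det,
    fun h0 => Matrix.det_mvPolynomialX_ne_zero (Fin r) k (rename_injective _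
      (Function.injective_id.prodMap (Fin.castLE_injective hr)) (by rw [h0, map_zero])), ?_⟩
  intro A hA
  let B : Matrix (Fin r) (Fin r) k := A.submatrix id (Fin.castLE hr)
  have hB : B.det ≠ 0 := by
    rw [eval_rename, RingHom.map_det] at hA
    convert hA
    ext i j
    simp [B]
  have hBA : B = A * (1 : Matrix (Fin n) (Fin n) k).submatrix id (Fin.castLE hr) := by
    ext i j
    simp [B, Matrix.mul_apply, Matrix.one_apply]
  refine le_antisymm (by simpa using A.rank_le_height) ?_
  have := Matrix.rank_of_isUnit B ((Matrix.isUnit_iff_isUnit_det B).mpr (isUnit_iff_ne_zero.mpr hB))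
  rw [Fintype.card_fin] at this
  exact this.symm.le.trans (hBA ▸ Matrix.rank_mul_le_left _ _)

/-- A generic linear form separates `x` from finitely many other points. -/
theorem exists_dotProduct_ne [Infinite k] (x : Fin n → k) {Z : Set (Fin n → k)} (hZ : Z.Finite)
    (hx : x ∉ Z) : ∃ l : Fin n → k, ∀ z ∈ Z, l ⬝ᵥ z ≠ l ⬝ᵥ x := by
  have h0 : ∏ z ∈ hZ.toFinset, (∑ j, C (z j - x j) * X j : MvPolynomial (Fin n) k) ≠ 0 := by
    refine Finset.prod_ne_zero_iff.mpr fun z hz h0 => hx ?_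
    have : z = x := funext fun j => by
      have := congr(eval (Pi.single j 1) $h0)
      simpa [Pi.single_apply, sub_eq_zero] using this
    exact this ▸ hZ.mem_toFinset.mp hz
  obtain ⟨l, hl⟩ := exists_eval_ne_zero h0
  refine ⟨l, fun z hz h => ?_⟩
  rw [map_prod, Finset.prod_ne_zero_iff] at hl
  refine hl z (hZ.mem_toFinset.mpr hz) ?_
  rw [← sub_eq_zero, ← dotProduct_sub] at h
  simpa [dotProduct, mul_comm] using h

theorem zeroLocus_vanishingIdeal_of_isZariskiClosed {V : Set (Fin n → k)} (hV : IsZariskiClosed V) :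
    zeroLocus k (vanishingIdeal k V) = V := by
  obtain ⟨I, rfl⟩ := hV
  exact zeroLocus_vanishingIdeal_galoisConnection.l_u_l_eq_l I

theorem isComponent_zeroLocus_of_mem_minimalPrimes [IsAlgClosed k] {V : Set (Fin n → k)}
    (hV : IsZariskiClosed V) {p : Ideal (MvPolynomial (Fin n) k)}
    (hp : p ∈ (vanishingIdeal k V).minimalPrimes) : IsComponent V (zeroLocus k p) := by
  have := hp.1.1
  refine ⟨⟨⟨⟨p, rfl⟩, ?_⟩, ?_⟩, ?_⟩
  · rwa [IsPrime.vanishingIdeal_zeroLocus]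
  · rw [← zeroLocus_vanishingIdeal_of_isZariskiClosed hV]
    exact zeroLocus_anti_mono hp.1.2
  · rintro Y ⟨⟨hY, hYp⟩, hYV⟩ hpY
    have h1 : vanishingIdeal k Y ≤ p := by
      rw [← IsPrime.vanishingIdeal_zeroLocus (K := k) p]
      exact vanishingIdeal_anti_mono hpY
    have h2 := hp.2 ⟨hYp, vanishingIdeal_anti_mono hYV⟩ h1
    rw [← zeroLocus_vanishingIdeal_of_isZariskiClosed hY]
    exact zeroLocus_anti_mono h2

/-- The equation of the image of `V` under a generic projection to affine space of dimension
`dim V + 1`, pulled back to the ambient space: it has degree at most `d`, vanishes on `V`,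
and does not vanish at the given point `x` outside of `V`. -/
theorem HasDegree.exists_mem_vanishingIdeal_eval_ne_zero [IsAlgClosed k] {d : ℕ}
    {V : Set (Fin n → k)} (hV : HasDegree V d) {x : Fin n → k} (hx : x ∉ V) :
    ∃ f ∈ vanishingIdeal k V, f.totalDegree ≤ d ∧ eval x f ≠ 0 := by
  obtain ⟨m, ⟨hmn, hclosed, hdim⟩, hgen⟩ := hV
  obtain ⟨r, hr⟩ : ∃ r, n - m = r := ⟨_, rfl⟩
  rw [hr] at hdim hgen
  obtain ⟨P, hP0, hP⟩ := hgen
  have hrn : r ≤ n := by omega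
  set I := vanishingIdeal k V with hI
  have hVI : zeroLocus k I = V := zeroLocus_vanishingIdeal_of_isZariskiClosed hclosed
  have hrad : I.IsRadical := by
    have := vanishingIdeal_zeroLocus_eq_radical (K := k) I
    rw [hVI] at this
    rw [← hI] at this
    rw [this]
    exact Ideal.radical_isRadical I
  have hfin := Ideal.finite_minimalPrimes_of_isNoetherianRing _ I
  have hsub : ∀ p ∈ I.minimalPrimes, zeroLocus k p ⊆ V := fun p hp =>
    (isComponent_zeroLocus_of_mem_minimalPrimes hclosed hp).1.2
  have hpdim : ∀ p ∈ I.minimalPrimes, ringKrullDim (MvPolynomial (Fin n) k ⧸ p) = r := by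
    intro p hp
    have := hp.1.1
    have h := hdim _ (isComponent_zeroLocus_of_mem_minimalPrimes hclosed hp)
    rwa [dim, IsPrime.vanishingIdeal_zeroLocus] at h
  -- Fix the constant terms `b₀`, to choose the linear part `A` first.
  obtain ⟨a₀, ha₀⟩ := exists_eval_ne_zero hP0
  let P₁ : MvPolynomial (Fin r × Fin n) k := aeval (Sum.elim X fun i => C (a₀ (Sum.inr i))) P
  have hP₁ : ∀ A : Fin r × Fin n → k,
      eval A P₁ = eval (Sum.elim A fun i => a₀ (Sum.inr i)) P := fun A => by
    rw [eval_aeval]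
    congr 2
    funext i
    rcases i with i | i <;> simp
  have hP₁0 : P₁ ≠ 0 := fun h0 => ha₀ (by
    have := hP₁ fun ij => a₀ (Sum.inl ij)
    rw [h0, map_zero] at this
    rw [this]
    congr 2
    funext i
    rcases i with i | i <;> rfl)
  obtain ⟨D, hD0, hD⟩ := exists_generic_rank_eq (k := k) hrn
  obtain ⟨A, hA, hAI⟩ := exists_generic_projHom_isIntegral hrad m r (by omega)
    (fun p hp => (hpdim p hp).le) _ (mul_ne_zero hP₁0 hD0)
  -- One more linear form `l`, separating `x` from the points of `V` with the same image under `A`.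
  obtain ⟨l, hl⟩ := exists_dotProduct_ne x
    (finite_fiber_of_projHom_isIntegral hAI fun i => A i ⬝ᵥ x) fun h => hx (hVI ▸ h.1)
  have hint : ∀ p ∈ I.minimalPrimes, (projHom (Fin.cons l A) p).IsIntegral := fun p hp =>
    projHom_cons_isIntegral (projHom_isIntegral_mono hp.1.2 hAI) l
  have hF : ∀ p : Ideal (MvPolynomial (Fin n) k), ∃ F : MvPolynomial (Fin (r + 1)) k,
      p ∈ I.minimalPrimes → Irreducible F ∧ (finSuccEquiv k r F).Monic ∧
        ∀ g, linMap (Fin.cons l A) g ∈ p ↔ F ∣ g := by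
    intro p
    by_cases hp : p ∈ I.minimalPrimes
    · have := hp.1.1
      obtain ⟨F, hF⟩ := exists_irreducible_projHom_eq_zero_iff
        (projHom_isIntegral_mono hp.1.2 hAI) (hpdim p hp).ge l
      exact ⟨F, fun _ => hF⟩
    · exact ⟨0, fun h => absurd h hp⟩
  choose F hF using hF
  have hlift : ∀ p ∈ I.minimalPrimes, ∀ u : Fin (r + 1) → k, eval u (F p) = 0 →
      ∃ z ∈ V, l ⬝ᵥ z = u 0 ∧ ∀ i, A i ⬝ᵥ z = u (Fin.succ i) := by
    intro p hp u hu
    obtain ⟨z, hz, hzu⟩ := exists_mem_zeroLocus_of_ker_vanishes p (linMap (Fin.cons l A))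
      (hint p hp) u fun f hf => by
        obtain ⟨g, rfl⟩ := ((hF p hp).2.2 f).mp hf
        rw [map_mul, hu, zero_mul]
    simp only [eval_linMap, eval_X] at hzu
    exact ⟨z, hsub p hp hz, hzu 0, fun i => hzu i.succ⟩
  classical
  -- Distinct components may have the same image, so the equations are multiplied without repetition.
  let S : Finset (MvPolynomial (Fin (r + 1)) k) := hfin.toFinset.image F
  have hS : ∀ G ∈ S, ∃ p ∈ I.minimalPrimes, F p = G := fun G hG => by
    simpa [S] using hG
  refine ⟨linMap (Fin.cons l A) (∏ G ∈ S, G), ?_, (totalDegree_linMap_le _ _).trans ?_, ?_⟩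
  · rw [← hrad.radical, ← Ideal.sInf_minimalPrimes, Ideal.mem_sInf]
    intro p hp
    rw [(hF p hp).2.2]
    exact Finset.dvd_prod_of_mem _ (Finset.mem_image_of_mem F (hfin.mem_toFinset.mpr hp))
  · obtain ⟨Q, hQ0, hQ⟩ := exists_generic_sub hA l
    let T (w : Fin r → k) : MvPolynomial (Fin r) k :=
      aeval (Sum.elim (fun ij : Fin r × Fin n => C ((A ij.1 - w ij.1 • l) ij.2)) X) P
    have hT : ∀ w t, eval t (T w) =
        eval (Sum.elim (fun ij : Fin r × Fin n => (A ij.1 - w ij.1 • l) ij.2) t) P := by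
      intro w t
      rw [eval_aeval]
      congr 2
      funext i
      rcases i with i | i <;> simp
    obtain ⟨w, t, hw, ht, R, hR, hRF⟩ := exists_line_meeting_hypersurface S
      (fun G hG => by obtain ⟨p, hp, rfl⟩ := hS G hG; exact (hF p hp).1)
      (fun G hG G' hG' hne hass => by
        obtain ⟨p, hp, rfl⟩ := hS G hG
        obtain ⟨p', hp', rfl⟩ := hS G' hG'
        exact hne ((finSuccEquiv k r).injective (Polynomial.eq_of_monic_of_associated
          (hF p hp).2.1 (hF p' hp').2.1 (hass.map (finSuccEquiv k r)))))
      hQ0 T (fun w hw h0 => by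
        rw [hQ, map_mul, hP₁] at hw
        exact left_ne_zero_of_mul hw (by rw [← hT, h0, map_zero]))
    let A' : Matrix (Fin r) (Fin n) k := fun i => A i - w i • l
    have hcard : (linearSubspace A' t ∩ V).encard = d := by
      refine hP A' t (hD A' ?_) ((hT w t).symm.trans_ne ht)
      rw [hQ, map_mul] at hw
      exact right_ne_zero_of_mul hw
    have hz : ∀ y ∈ R, ∃ z ∈ linearSubspace A' t ∩ V, l ⬝ᵥ z = y := by
      intro y hy
      have := hRF y hy
      rw [map_prod, Finset.prod_eq_zero_iff] at this
      obtain ⟨G, hG, hG0⟩ := this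
      obtain ⟨p, hp, rfl⟩ := hS G hG
      obtain ⟨z, hzV, hz0, hzA⟩ := hlift p hp _ hG0
      refine ⟨z, ⟨funext fun i => ?_, hzV⟩, hz0⟩
      rw [Fin.cons_zero] at hz0
      have hi := hzA i
      rw [Fin.cons_succ] at hi
      change (A i - w i • l) ⬝ᵥ z = t i
      rw [sub_dotProduct, smul_dotProduct, hi, hz0, smul_eq_mul, add_sub_cancel_right]
    have hle : (R : Set k).encard ≤ (linearSubspace A' t ∩ V).encard := by
      refine le_trans (Set.encard_le_encard ?_) (Set.encard_image_le (fun z => l ⬝ᵥ z) _)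
      exact fun y hy => hz y hy
    rw [hcard, Set.encard_coe_eq_coe_finsetCard, hR] at hle
    exact_mod_cast hle
  · rw [eval_linMap, map_prod, Finset.prod_ne_zero_iff]
    intro G hG h0
    obtain ⟨p, hp, rfl⟩ := hS G hG
    obtain ⟨z, hzV, hz0, hzA⟩ := hlift p hp _ h0
    exact hl z ⟨hVI ▸ hzV, hzA⟩ hz0

end AffineDegree

theorem mainTheorem5 {k : Type*} [Field k] [IsAlgClosed k] (n d : ℕ)
    (V : Set (Fin n → k)) (hV : AffineDegree.HasDegree V d) :
    ∃ q : Ideal (MvPolynomial (Fin n) k),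
      (∃ S : Set (MvPolynomial (Fin n) k),
        (∀ f ∈ S, f.totalDegree ≤ d) ∧ q = Ideal.span S) ∧
      q.radical = MvPolynomial.vanishingIdeal k V ∧
      MvPolynomial.zeroLocus k q = V := by
  let S : Set (MvPolynomial (Fin n) k) :=
    {f | f ∈ MvPolynomial.vanishingIdeal k V ∧ f.totalDegree ≤ d}
  have hzero : MvPolynomial.zeroLocus k (Ideal.span S) = V := by
    refine Set.Subset.antisymm (fun x hx => ?_) ?_
    · by_contra hxV
      obtain ⟨f, hfV, hfd, hfx⟩ := hV.exists_mem_vanishingIdeal_eval_ne_zero hxV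
      exact hfx (by simpa [MvPolynomial.aeval_eq_eval] using hx f (Ideal.subset_span ⟨hfV, hfd⟩))
    · exact MvPolynomial.le_zeroLocus_iff_le_vanishingIdeal.mpr (Ideal.span_le.mpr fun f hf => hf.1)
  refine ⟨Ideal.span S, ⟨S, fun f hf => hf.2, rfl⟩, ?_, hzero⟩
  rw [← MvPolynomial.vanishingIdeal_zeroLocus_eq_radical (K := k), hzero]
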